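/- Let $A$ be a unital $C^*$-algebra and let $V$ be a Hilbert $A$-module: an $A$-module with an $A$-valued inner product $\langle\cdot,\cdot\rangle$ that is $A$-linear in the second variable, satisfies $\langle x,y\rangle^*=\langle y,x\rangle$, is positive ($\langle x,x\rangle\ge 0$) and definite ($\langle x,x\rangle=0$ only for $x=0$), such that $V$ is complete for the norm $\|x\|=\|\langle x,x\rangle\|^{1/2}$. (The statement is formalized for left modules, so $\langle x,ay\rangle=a\langle x,y\rangle$; a right Hilbert $A$-module is the same thing as a left Hilbert module over the opposite $C^*$-algebra.) Let $\tau_{\widehat V}$ be the locally convex topology on $V$ generated by the seminorms $x\mapsto\|\langle z,x\rangle\|$, $z\in V$. Suppose that $V$ is countably generated (there is a sequence in $V$ whose finite $A$-linear combinations are norm-dense in $V$) and that $V$ has the module Schur property (every sequence in $V$ that converges to an element of $V$ with respect to $\tau_{\widehat V}$ converges in norm). Then $V$ is self-dual: for every bounded $A$-linear map $f:V\to A$ there is $x\in V$ such that $f(y)=\langle x,y\rangle$ for all $y\in V$. -/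

import Mathlib

open Filter Topology

namespace HilbertCStar

section

variable (A E : Type*) [CStarAlgebra A] [PartialOrder A] [StarOrderedRing A]
  [NormedAddCommGroup E] [NormedSpace ℂ E] [Module A E] [CStarModule A E]

/-- The seminorms `μ_z (x) = ‖⟪z, x⟫‖` on a Hilbert `A`-module `E`, indexed by `z : E`. -/
noncomputable def innerSeminorms : SeminormFamily ℂ E E := fun z =>
  (normSeminorm ℂ A).comp (CStarModule.innerₛₗ (A := A) z)

/-- The locally convex topology on a Hilbert `A`-module `E` generated by the seminorms
`x ↦ ‖⟪z, x⟫‖`, `z ∈ E`. It is passed explicitly and is not an instance: the topology found by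
instance search on `E` is always the norm topology. -/
noncomputable abbrev weakModuleTopology : TopologicalSpace E :=
  (innerSeminorms A E).moduleFilterBasis.topology

/-- Module Schur property: every sequence in `E` that converges in the weak module topology
converges in norm. -/
def ModuleSchur : Prop :=
  ∀ u : ℕ → E, (∃ x : E, Tendsto u atTop (@nhds E (weakModuleTopology A E) x)) →
    ∃ y : E, Tendsto u atTop (𝓝 y)

/-- `E` is countably generated: the finite `A`-linear combinations of the members of some sequence
are norm-dense in `E`. -/
def CountablyGenerated : Prop :=
  ∃ g : ℕ → E, Dense (Submodule.span A (Set.range g) : Set E)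

/-- `E` is self-dual: each bounded `A`-linear map `f : E → A` is `y ↦ ⟪x, y⟫` for some `x ∈ E`. -/
def SelfDual : Prop :=
  ∀ f : E →L[A] A, ∃ x : E, ∀ y : E, f y = inner A x y

end

end HilbertCStar

namespace HilbertCStar

section

open CStarModule

variable {A E : Type*} [CStarAlgebra A] [PartialOrder A]
  [NormedAddCommGroup E] [NormedSpace ℂ E] [Module A E] [CStarModule A E]

/-- Vectors of a Hilbert module with the same inner products are equal. -/
lemma ext_inner_left {x y : E} (h : ∀ z : E, inner A z x = inner A z y) : x = y := by
  rw [← sub_eq_zero, ← CStarModule.inner_self (A := A)]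
  simp [h]

/-- The scalars of `ℂ` act on a Hilbert `A`-module through `A`. -/
lemma algebraMap_smul_eq (c : ℂ) (x : E) : algebraMap ℂ A c • x = c • x :=
  ext_inner_left (A := A) fun z => by
    simp [Algebra.smul_def]

lemma norm_smul_le_mul (a : A) (x : E) : ‖a • x‖ ≤ ‖a‖ * ‖x‖ := by
  refine (pow_le_pow_iff_left₀ (norm_nonneg _) (by positivity) two_ne_zero).1 ?_
  rw [norm_sq_eq A, mul_pow, norm_sq_eq A (x := x), inner_op_smul_right, inner_op_smul_left]
  calc ‖a * (inner A x x * star a)‖ ≤ ‖a‖ * (‖inner A x x‖ * ‖star a‖) :=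
        (norm_mul_le _ _).trans (mul_le_mul_of_nonneg_left (norm_mul_le _ _) (norm_nonneg _))
    _ = ‖a‖ ^ 2 * ‖inner A x x‖ := by rw [norm_star]; ring

/-- The rank-one map `x ↦ ⟪g, x⟫ • g`. -/
def rankOne (g : E) : E →ₗ[A] E where
  toFun x := inner A g x • g
  map_add' x y := by simp [add_smul]
  map_smul' a x := by simp [mul_smul]

lemma rankOne_apply (g x : E) : rankOne (A := A) g x = inner A g x • g := rfl

lemma inner_sum_rankOne {ι : Type*} (s : Finset ι) (g : ι → E) (x : E) :
    inner A x ((∑ i ∈ s, rankOne (A := A) (g i)) x) =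
      ∑ i ∈ s, inner A (g i) x * inner A x (g i) := by
  simp [LinearMap.sum_apply, rankOne_apply]

/-- A countably generated Hilbert module has generators with `∑ ‖g i‖ ^ 2 ≤ 1`. -/
lemma CountablyGenerated.exists_sum_norm_sq_le (h : CountablyGenerated A E) :
    ∃ g : ℕ → E, Dense (Submodule.span A (Set.range g) : Set E) ∧
      ∀ n, ∑ i ∈ Finset.range n, ‖g i‖ ^ 2 ≤ 1 := by
  obtain ⟨g, hg⟩ := h
  set r : ℕ → ℝ := fun i => (1 / 2) ^ (i + 1) / (1 + ‖g i‖) with hr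
  have hr0 i : 0 < r i := by positivity
  refine ⟨fun i => (r i : ℂ) • g i, hg.mono ?_, fun n => ?_⟩
  · refine Submodule.span_le.2 ?_
    rintro _ ⟨i, rfl⟩
    have := Submodule.smul_mem (Submodule.span A (Set.range fun i => (r i : ℂ) • g i))
      (algebraMap ℂ A (r i : ℂ)⁻¹) (Submodule.subset_span ⟨i, rfl⟩)
    rwa [algebraMap_smul_eq, inv_smul_smul₀ (by exact_mod_cast (hr0 i).ne')] at this
  · have hle i : ‖(r i : ℂ) • g i‖ ^ 2 ≤ (1 / 2) ^ (i + 1) := by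
      have h1 : ‖(r i : ℂ) • g i‖ ≤ (1 / 2) ^ (i + 1) := by
        rw [norm_smul, Complex.norm_real, Real.norm_of_nonneg (hr0 i).le, hr, div_mul_eq_mul_div]
        exact div_le_of_le_mul₀ (by positivity) (by positivity)
          (mul_le_mul_of_nonneg_left (by linarith) (by positivity))
      exact (pow_le_of_le_one (norm_nonneg _)
        (h1.trans (pow_le_one₀ (by norm_num) (by norm_num))) two_ne_zero).trans h1
    have hsum (n : ℕ) : ∑ i ∈ Finset.range n, ((1 : ℝ) / 2) ^ (i + 1) = 1 - (1 / 2) ^ n := by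
      induction n with
      | zero => simp
      | succ n ih => rw [Finset.sum_range_succ, ih]; ring
    refine (Finset.sum_le_sum fun i _ => hle i).trans ?_
    rw [hsum]
    exact sub_le_self _ (by positivity)

lemma tendsto_weakModuleTopology_iff {u : ℕ → E} {x : E} :
    Tendsto u atTop (@nhds E (weakModuleTopology A E) x) ↔
      ∀ z : E, Tendsto (fun n => inner A z (u n - x)) atTop (𝓝 0) := by
  have hp : @WithSeminorms ℂ E E _ _ _ (innerSeminorms A E) (weakModuleTopology A E) :=
    @WithSeminorms.mk ℂ E E _ _ _ (innerSeminorms A E) (weakModuleTopology A E) rfl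
  rw [@WithSeminorms.tendsto_nhds ℂ E ℕ E _ _ _ (weakModuleTopology A E) _ hp]
  simp only [Metric.tendsto_nhds, dist_zero_right]
  rfl

/-- A positive contraction of a Hilbert module. -/
structure IsPositiveContraction (G : Module.End A E) : Prop where
  symm : ∀ x y, inner A (G x) y = inner A x (G y)
  nonneg : ∀ x, 0 ≤ inner A x (G x)
  le_one : ∀ x, inner A x (G x) ≤ inner A x x

lemma inner_pow_symm {T : Module.End A E} (h : ∀ x y, inner A (T x) y = inner A x (T y)) (k : ℕ)
    (x y : E) : inner A ((T ^ k) x) y = inner A x ((T ^ k) y) := by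
  induction k generalizing x y with
  | zero => simp
  | succ k ih => rw [pow_succ, Module.End.mul_apply, ih, h, ← Module.End.mul_apply, ← pow_succ',
      ← pow_succ]

lemma inner_mul_pow_nonneg {P T : Module.End A E} (h : ∀ x y, inner A (T x) y = inner A x (T y))
    (hc : Commute P T) (h0 : ∀ x, 0 ≤ inner A x (P x)) (h1 : ∀ x, 0 ≤ inner A x (P (T x)))
    (k : ℕ) (x : E) : 0 ≤ inner A x (P ((T ^ k) x)) := by
  obtain ⟨j, rfl | rfl⟩ := k.even_or_odd'
  · have := h0 ((T ^ j) x)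
    rw [inner_pow_symm h, ← Module.End.mul_apply, ← Module.End.mul_apply,
      ← (hc.pow_right j).eq, mul_assoc, ← pow_add, ← two_mul] at this
    exact this
  · have := h1 ((T ^ j) x)
    rw [inner_pow_symm h, ← Module.End.mul_apply, ← Module.End.mul_apply, ← Module.End.mul_apply,
      ← (hc.pow_right j).eq, mul_assoc, mul_assoc, ← pow_succ', ← pow_add,
      show j + (j + 1) = 2 * j + 1 by ring] at this
    exact this

variable [StarOrderedRing A]

namespace IsPositiveContraction

variable {G : Module.End A E}

lemma compl (hG : IsPositiveContraction G) : IsPositiveContraction (1 - G) where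
  symm x y := by simp [hG.symm]
  nonneg x := by simpa using hG.le_one x
  le_one x := by simpa using hG.nonneg x

lemma inner_pow_nonneg (hG : IsPositiveContraction G) (k : ℕ) (x : E) :
    0 ≤ inner A x (((1 - G) ^ k) x) :=
  inner_mul_pow_nonneg (P := 1) hG.compl.symm (Commute.one_left _)
    (fun _ => CStarModule.inner_self_nonneg) hG.compl.nonneg k x

lemma inner_sq_mul_pow_nonneg (hG : IsPositiveContraction G) (k : ℕ) (x : E) :
    0 ≤ inner A x (G (G (((1 - G) ^ k) x))) := by
  refine inner_mul_pow_nonneg (P := G * G) hG.compl.symm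
    (by simp only [Commute, SemiconjBy]; noncomm_ring) (fun y => ?_) (fun y => ?_) k x
  · rw [Module.End.mul_apply, ← hG.symm]
    exact CStarModule.inner_self_nonneg
  · have := hG.compl.nonneg (G y)
    rw [hG.symm] at this
    simpa using this

/-- The telescoping estimate `m ⟪x, G (1 - G) ^ m x⟫ ≤ ⟪x, x⟫`. -/
lemma nsmul_inner_mul_pow_le (hG : IsPositiveContraction G) (m : ℕ) (x : E) :
    m • inner A x (G (((1 - G) ^ m) x)) ≤ inner A x x := by
  suffices h : m • inner A x (G (((1 - G) ^ m) x)) ≤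
      inner A x x - inner A x (((1 - G) ^ m) x) from
    h.trans (sub_le_self _ (hG.inner_pow_nonneg m x))
  induction m with
  | zero => simp
  | succ m ih =>
    have hs : ((1 - G) ^ (m + 1)) x = ((1 - G) ^ m) x - G (((1 - G) ^ m) x) := by
      rw [pow_succ', Module.End.mul_apply]; simp
    have hle : inner A x (G (((1 - G) ^ (m + 1)) x)) ≤ inner A x (G (((1 - G) ^ m) x)) := by
      rw [hs, map_sub, CStarModule.inner_sub_right]
      exact sub_le_self _ (hG.inner_sq_mul_pow_nonneg m x)
    calc (m + 1) • inner A x (G (((1 - G) ^ (m + 1)) x))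
        ≤ (m + 1) • inner A x (G (((1 - G) ^ m) x)) := nsmul_le_nsmul_right hle _
      _ ≤ inner A x x - inner A x (((1 - G) ^ m) x) + inner A x (G (((1 - G) ^ m) x)) := by
        rw [succ_nsmul]; gcongr
      _ = inner A x x - inner A x (((1 - G) ^ (m + 1)) x) := by
        rw [hs, CStarModule.inner_sub_right]; abel

lemma inner_pow_mul_pow_nonneg (hG : IsPositiveContraction G) (k : ℕ) (x : E) :
    0 ≤ inner A x (G (((1 - G) ^ k) x)) := by
  refine inner_mul_pow_nonneg (P := G) hG.compl.symm
    (by simp only [Commute, SemiconjBy]; noncomm_ring) hG.nonneg (fun y => ?_) k x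
  have h1 := hG.nonneg ((1 - G) y)
  have h2 := hG.compl.nonneg (G y)
  rw [hG.compl.symm] at h1
  rw [hG.symm] at h2
  have h : G ((1 - G) y) = (1 - G) (G ((1 - G) y)) + G ((1 - G) (G y)) := by
    simp
  rw [h, CStarModule.inner_add_right]
  exact add_nonneg h1 h2

lemma norm_compl_apply_le (hG : IsPositiveContraction G) (x : E) : ‖(1 - G) x‖ ≤ ‖x‖ := by
  have h : inner A ((1 - G) x) ((1 - G) x) ≤ inner A x x := by
    rw [hG.compl.symm]
    have h1 := hG.inner_pow_mul_pow_nonneg 1 x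
    have h2 := hG.nonneg x
    have e : (1 - G) ((1 - G) x) = x - (G x + G (((1 - G) ^ 1 : Module.End A E) x)) := by
      simp; abel
    rw [e, CStarModule.inner_sub_right, CStarModule.inner_add_right]
    exact sub_le_self _ (add_nonneg h2 h1)
  rw [norm_eq_sqrt_norm_inner_self (A := A), norm_eq_sqrt_norm_inner_self (A := A) x]
  exact Real.sqrt_le_sqrt
    (CStarAlgebra.norm_le_norm_of_nonneg_of_le CStarModule.inner_self_nonneg h)

lemma norm_compl_pow_apply_le (hG : IsPositiveContraction G) (k : ℕ) (x : E) :
    ‖((1 - G) ^ k) x‖ ≤ ‖x‖ := by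
  induction k with
  | zero => simp
  | succ k ih =>
    rw [pow_succ', Module.End.mul_apply]
    exact (hG.norm_compl_apply_le _).trans ih

/-- Powers of `1 - G` are small on a vector `g` whose rank-one map is dominated by `G`. -/
lemma mul_norm_pow_apply_sq_le (hG : IsPositiveContraction G) {g : E}
    (hg : ∀ x, inner A g x * inner A x g ≤ inner A x (G x)) (m : ℕ) :
    m * ‖((1 - G) ^ m) g‖ ^ 2 ≤ 1 := by
  set h := ((1 - G) ^ m) g with hh
  have h1 : m • (inner A h h * inner A h h) ≤ inner A h h := by
    have e1 := hg (((1 - G) ^ m) h)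
    rw [← inner_pow_symm hG.compl.symm m g h, inner_pow_symm hG.compl.symm m h g,
      inner_pow_symm hG.compl.symm m h (G _), ← hh] at e1
    have hc : ((1 - G) ^ m) (G (((1 - G) ^ m) h)) = G (((1 - G) ^ (2 * m)) h) := by
      have : Commute G ((1 - G) ^ m) :=
        Commute.pow_right (by simp only [Commute, SemiconjBy]; noncomm_ring) m
      rw [← Module.End.mul_apply, ← this.eq, Module.End.mul_apply,
        ← Module.End.mul_apply ((1 - G) ^ m), ← pow_add, ← two_mul]
    rw [hc] at e1
    have hn := hG.inner_pow_mul_pow_nonneg (2 * m) h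
    calc m • (inner A h h * inner A h h) ≤ m • inner A h (G (((1 - G) ^ (2 * m)) h)) :=
          nsmul_le_nsmul_right e1 _
      _ ≤ (2 * m) • inner A h (G (((1 - G) ^ (2 * m)) h)) :=
          nsmul_le_nsmul_left hn (by omega)
      _ ≤ inner A h h := hG.nsmul_inner_mul_pow_le (2 * m) h
  have hs : IsSelfAdjoint (inner A h h) := isSelfAdjoint_inner_self
  have hpos : 0 ≤ m • (inner A h h * inner A h h) :=
    nsmul_nonneg (by simpa [hs.star_eq] using mul_star_self_nonneg (inner A h h)) _
  have h2 := CStarAlgebra.norm_le_norm_of_nonneg_of_le hpos h1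
  have h3 : ‖inner A h h * inner A h h‖ = ‖inner A h h‖ * ‖inner A h h‖ := by
    conv_lhs => rw [← hs.star_eq, hs.star_eq]
    simpa [hs.star_eq] using CStarRing.norm_self_mul_star (x := inner A h h)
  rw [← Nat.cast_smul_eq_nsmul ℝ, norm_smul, h3, ← norm_sq_eq A, Real.norm_natCast] at h2
  rcases (sq_nonneg ‖h‖).eq_or_lt with h0 | h0
  · rw [← h0]; simp
  · exact le_of_mul_le_mul_right (by linarith) h0

end IsPositiveContraction

lemma inner_rankOne_nonneg (g x : E) : 0 ≤ inner A g x * inner A x g := by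
  rw [← star_inner x g]
  exact star_mul_self_nonneg _

lemma isPositiveContraction_sum_rankOne {ι : Type*} (s : Finset ι) (g : ι → E)
    (hs : ∑ i ∈ s, ‖g i‖ ^ 2 ≤ 1) :
    IsPositiveContraction (∑ i ∈ s, rankOne (A := A) (g i)) where
  symm x y := by
    simp [LinearMap.sum_apply, rankOne_apply]
  nonneg x := by
    rw [inner_sum_rankOne]
    exact Finset.sum_nonneg fun i _ => inner_rankOne_nonneg _ _
  le_one x := by
    rw [inner_sum_rankOne]
    calc ∑ i ∈ s, inner A (g i) x * inner A x (g i)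
        ≤ ∑ i ∈ s, ‖g i‖ ^ 2 • inner A x x := Finset.sum_le_sum fun i _ => inner_mul_inner_swap_le
      _ = (∑ i ∈ s, ‖g i‖ ^ 2) • inner A x x := (Finset.sum_smul ..).symm
      _ ≤ (1 : ℝ) • inner A x x := smul_le_smul_of_nonneg_right hs CStarModule.inner_self_nonneg
      _ = inner A x x := one_smul _ _

/-- `f - f ∘ (1 - G) ^ n` is given by an inner product when `G` is a sum of rank-one maps. -/
lemma exists_inner_eq_sub {ι : Type*} (s : Finset ι) (g : ι → E)
    (hs : IsPositiveContraction (∑ i ∈ s, rankOne (A := A) (g i))) (f : E →L[A] A) (n : ℕ) :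
    ∃ u : E, ∀ z : E, inner A u z =
      f z - f (((1 - ∑ i ∈ s, rankOne (A := A) (g i) : Module.End A E) ^ n) z) := by
  induction n with
  | zero => exact ⟨0, fun z => by simp⟩
  | succ n ih =>
    obtain ⟨u, hu⟩ := ih
    refine ⟨∑ i ∈ s, star (f (g i)) • g i +
      (1 - ∑ i ∈ s, rankOne (A := A) (g i) : Module.End A E) u, fun z => ?_⟩
    have hw : inner A (∑ i ∈ s, star (f (g i)) • g i) z =
        f ((∑ i ∈ s, rankOne (A := A) (g i)) z) := by
      simp [LinearMap.sum_apply, rankOne_apply]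
    rw [CStarModule.inner_add_left, hs.compl.symm, hu, hw, pow_succ, Module.End.mul_apply,
      LinearMap.sub_apply, Module.End.one_apply, map_sub f]
    abel

/-- For generators `g`, the powers `(1 - ∑ i < n, rankOne (g i)) ^ n` tend to zero pointwise. -/
lemma tendsto_compl_sum_rankOne_pow {g : ℕ → E}
    (hg : Dense (Submodule.span A (Set.range g) : Set E))
    (hs : ∀ n, ∑ i ∈ Finset.range n, ‖g i‖ ^ 2 ≤ 1) (z : E) :
    Tendsto (fun n : ℕ =>
      ((1 - ∑ i ∈ Finset.range n, rankOne (A := A) (g i) : Module.End A E) ^ n) z) atTop (𝓝 0) := by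
  set S : ℕ → Module.End A E := fun n => (1 - ∑ i ∈ Finset.range n, rankOne (A := A) (g i)) ^ n
    with hS
  have hG n := isPositiveContraction_sum_rankOne (A := A) (Finset.range n) g (hs n)
  change Tendsto (fun n => S n z) atTop (𝓝 0)
  have hgen (j : ℕ) : Tendsto (fun n => S n (g j)) atTop (𝓝 0) := by
    have hsq : Tendsto (fun n => ‖S n (g j)‖ ^ 2) atTop (𝓝 0) := by
      refine squeeze_zero' (.of_forall fun n => sq_nonneg _) ?_
        (tendsto_one_div_atTop_nhds_zero_nat (𝕜 := ℝ))
      filter_upwards [eventually_gt_atTop j] with n hn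
      have h0 : (0 : ℝ) < n := by exact_mod_cast (Nat.zero_le j).trans_lt hn
      rw [le_div_iff₀' h0]
      refine (hG n).mul_norm_pow_apply_sq_le (fun x => ?_) n
      rw [inner_sum_rankOne]
      exact Finset.single_le_sum (f := fun i => inner A (g i) x * inner A x (g i))
        (fun i _ => inner_rankOne_nonneg _ _) (Finset.mem_range.2 hn)
    rw [tendsto_zero_iff_norm_tendsto_zero]
    simpa using hsq.sqrt
  have hspan {w : E} (hw : w ∈ Submodule.span A (Set.range g)) :
      Tendsto (fun n => S n w) atTop (𝓝 0) := by
    induction hw using Submodule.span_induction with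
    | mem x hx => obtain ⟨j, rfl⟩ := hx; exact hgen j
    | zero => simp
    | add x y _ _ hx hy => simpa using hx.add hy
    | smul a x _ hx =>
      rw [tendsto_zero_iff_norm_tendsto_zero] at hx ⊢
      refine squeeze_zero (fun n => norm_nonneg _) (fun n => ?_)
        (by simpa using hx.const_mul ‖a‖)
      rw [map_smul]
      exact norm_smul_le_mul a _
  rw [Metric.tendsto_atTop]
  intro ε hε
  obtain ⟨w, hw, hzw⟩ := Metric.dense_iff.1 hg z (ε / 2) (half_pos hε)
  obtain ⟨N, hN⟩ := Metric.tendsto_atTop.1 (hspan hzw) (ε / 2) (half_pos hε)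
  refine ⟨N, fun n hn => ?_⟩
  have h1 : ‖S n (z - w)‖ ≤ ‖z - w‖ := (hG n).norm_compl_pow_apply_le n (z - w)
  have h2 := hN n hn
  rw [Metric.mem_ball, dist_comm, dist_eq_norm] at hw
  rw [dist_zero_right] at h2 ⊢
  calc ‖S n z‖ = ‖S n (z - w) + S n w‖ := by rw [← map_add, sub_add_cancel]
    _ ≤ ‖S n (z - w)‖ + ‖S n w‖ := norm_add_le _ _
    _ < ε := by linarith

/-- Under the module Schur property, a sequence whose inner products with each vector converge is
Cauchy in norm. -/
lemma ModuleSchur.cauchySeq (h : ModuleSchur A E) {u : ℕ → E} {f : E → A}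
    (hu : ∀ z, Tendsto (fun n => inner A (u n) z) atTop (𝓝 (f z))) : CauchySeq u := by
  by_contra hc
  rw [Metric.cauchySeq_iff] at hc
  push Not at hc
  obtain ⟨ε, hε, hc⟩ := hc
  choose m hm n hn hmn using hc
  have hm' : Tendsto m atTop atTop := tendsto_atTop_mono hm tendsto_id
  have hn' : Tendsto n atTop atTop := tendsto_atTop_mono hn tendsto_id
  have h0 (z : E) : Tendsto (fun N => inner A z (u (m N) - u (n N))) atTop (𝓝 0) := by
    have := (((hu z).comp hm').sub ((hu z).comp hn')).star
    simpa [Function.comp_def] using this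
  obtain ⟨y, hy⟩ := h (fun N => u (m N) - u (n N))
    ⟨0, tendsto_weakModuleTopology_iff.2 fun z => by simpa using h0 z⟩
  have hy0 : y = 0 := ext_inner_left (A := A) fun z => by
    rw [CStarModule.inner_zero_right]
    exact tendsto_nhds_unique (((innerSL (A := A) z).continuous.tendsto y).comp hy) (h0 z)
  subst hy0
  obtain ⟨N, hN⟩ := (Metric.tendsto_atTop.1 hy ε hε)
  have := hN N le_rfl
  rw [dist_zero_right, ← dist_eq_norm] at this
  exact this.not_ge (hmn N)

end

end HilbertCStar

theorem mainTheorem7 (A E : Type*) [CStarAlgebra A] [PartialOrder A] [StarOrderedRing A]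
    [NormedAddCommGroup E] [NormedSpace ℂ E] [Module A E] [CStarModule A E] [CompleteSpace E]
    (hgen : HilbertCStar.CountablyGenerated A E) (hschur : HilbertCStar.ModuleSchur A E) :
    HilbertCStar.SelfDual A E := by
  intro f
  obtain ⟨g, hg, hs⟩ := hgen.exists_sum_norm_sq_le
  choose u hu using fun n => HilbertCStar.exists_inner_eq_sub (Finset.range n) g
    (HilbertCStar.isPositiveContraction_sum_rankOne (A := A) (Finset.range n) g (hs n)) f n
  have hlim (z : E) : Tendsto (fun n => inner A (u n) z) atTop (𝓝 (f z)) := by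
    simp only [hu]
    have := (f.continuous.tendsto 0).comp (HilbertCStar.tendsto_compl_sum_rankOne_pow hg hs z)
    rw [map_zero] at this
    simpa using this.const_sub (f z)
  obtain ⟨x, hx⟩ := cauchySeq_tendsto_of_complete (hschur.cauchySeq hlim)
  refine ⟨x, fun y => tendsto_nhds_unique (hlim y) ?_⟩
  exact ((CStarModule.continuous_inner (A := A) (E := E)).tendsto (x, y)).comp
    (hx.prodMk_nhds tendsto_const_nhds)
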